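/- **Setting.** Let $U$ be a finite linearly ordered set and $M=(U,\mathcal L)$, $\mathcal L\subseteq\{-1,0,+1\}^U$, a simple oriented matroid, that is: $0\in\mathcal L$; $\mathcal L$ is closed under $X\mapsto -X$ and under composition $X\circ Y$ (where $(X\circ Y)_e=X_e$ if $X_e\neq 0$ and $(X\circ Y)_e=Y_e$ otherwise); for $X,Y\in\mathcal L$ and $e$ in the separator $\mathrm{Sep}(X,Y)=\{f: X_fY_f=-1\}$ there is $Z\in\mathcal L$ with $Z_e=0$ and $Z_f=(X\circ Y)_f$ for all $f\notin \mathrm{Sep}(X,Y)$; every $e\in U$ takes all three signs on $\mathcal L$; and for $e\ne f$ in $U$ the product $X_eX_f$ takes both values $+1$ and $-1$ on $\mathcal L$. Sign vectors are ordered by the product order $\le$ relative to $0\le -1,+1$; $\underline X$ is the support of $X$ and $X^0=U\setminus\underline X$ its zero set. Topes are the maximal elements of $\mathcal L$, cocircuits its minimal nonzero elements. Topes are identified with the subsets $\{e : T_e=+1\}$ of $U$; shattering by $M$ and the VC-dimension of $M$ refer to this set family. For $A\subseteq U$, $X\setminus A$ is the restriction of $X$ to $U\setminus A$, and $M\setminus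 A=(U\setminus A,\{X\setminus A:X\in\mathcal L\})$. A sign vector $S$ on $U$ is a *realizable sample* if $S\le X$ for some $X\in\mathcal L$; then $[S]$ denotes the set of topes $T$ with $S\le T$. A realizable sample $S$ is *full* if the family of restrictions of the topes of $M$ to $U\setminus S^0$ has the same VC-dimension as $M$. For a set $H$ of topes, $\mathrm{osc}(H)$ is the set of all $e\in U$ such that no two topes in $H$ differ exactly in $e$, but some tope in $H$ and some tope not in $H$ differ exactly in $e$. The set $f_M(S)$, for a full sample $S$ of $M$, is defined recursively. If $S$ is not a tope, $f_M(S)=f_{M\setminus S^0}(S\setminus S^0)$. If $S$ is a tope, and $U\neq\varnothing$, then $f_M(S)=\{e_S\}\cup f_{M\setminus\underline X}(S\setminus\underline X)$, where $e_S$ is the smallest element of $\mathrm{osc}([S])$ and $X$ is the lexicographically minimal (with signs ordered $0<+<-$) cocircuit of $M$ with $X\le S$ and $e_S\in\underline X$; and $f_M(S)=\varnothing$ if $U=\varnothing$. Two full samples $S,S'$ are *equivalent*, $S\sim S'$, if $f_M(S)=f_M(S')$ and $S_e=S'_e$ for all $e\in f_M(S)$. **Lemma (distinguishing lemma).** Let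 $M=(U,\mathcal L)$ be a simple oriented matroid of VC-dimension $d$. Then $f_M$ maps full samples of $M$ to $d$-element subsets of $U$, and (i) $f_M(S)\subseteq \mathrm{osc}([S])$ for every full sample $S$; (ii) $f_M(S)$ is shattered by $M$ for every full sample $S$; (iii) for every equivalence class $\Omega$ of $\sim$ on the set of full samples of $M$, $\bigcap_{S\in\Omega}[S]\neq\varnothing$. -/

import Mathlib

/-! Sign vectors are functions `α → SignType`. The order on sign vectors used here is the product
of the order `0 ≤ -1`, `0 ≤ 1` (not the linear order that Mathlib puts on `SignType`). -/

namespace SignVec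

variable {α : Type*}

/-- The product order `X ≤ Y` of sign vectors, relative to `0 ≤ -1, +1`. -/
def Le (X Y : α → SignType) : Prop := ∀ e, X e ≠ 0 → X e = Y e

/-- The separator `{e | X e * Y e = -1}`. -/
def sep (X Y : α → SignType) : Set α := {e | X e * Y e = -1}

/-- The composition `X ∘ Y`. -/
def comp (X Y : α → SignType) : α → SignType := fun e => if X e = 0 then Y e else X e

/-- The position of a sign in the order `0 < + < -`. -/
def lexPos : SignType → ℕ
  | .zero => 0
  | .pos => 1
  | .neg => 2

/-- Strict lexicographic order of sign vectors, with the signs ordered by `0 < + < -`. -/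
def LexLt [LinearOrder α] (X Y : α → SignType) : Prop :=
  ∃ e, (∀ e' < e, X e' = Y e') ∧ lexPos (X e) < lexPos (Y e)

/-- The restriction `X ∖ A`; a sign vector on a subset of `α` is encoded by its extension by 0. -/
def delete [DecidableEq α] (X : α → SignType) (A : Finset α) : α → SignType :=
  fun e => if e ∈ A then 0 else X e

end SignVec

/-- A system of sign vectors `(U, 𝓛)` on a finite ground set `U`. A map from `U` to
`{-1, 0, +1}` is encoded by the function on `α` that extends it by `0` outside of `U`. -/
structure SignSystem (α : Type*) where
  ground : Finset α
  covectors : Set (α → SignType)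
  eq_zero_of_notMem : ∀ X ∈ covectors, ∀ e, e ∉ ground → X e = 0

namespace SignSystem

variable {α : Type*} [LinearOrder α]

/-- Simplicity: every element takes all three signs, and no two distinct elements are parallel
or antiparallel. -/
structure IsSimple (M : SignSystem α) : Prop where
  all_signs : ∀ e ∈ M.ground, ∀ s : SignType, ∃ X ∈ M.covectors, X e = s
  not_parallel : ∀ e ∈ M.ground, ∀ f ∈ M.ground, e ≠ f →
    ∃ X ∈ M.covectors, ∃ Y ∈ M.covectors, X e * X f = 1 ∧ Y e * Y f = -1

/-- A (simple) oriented matroid, by the covector axioms. -/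
structure IsOM (M : SignSystem α) : Prop where
  simple : M.IsSimple
  zero_mem : (0 : α → SignType) ∈ M.covectors
  comp_mem : ∀ X ∈ M.covectors, ∀ Y ∈ M.covectors, SignVec.comp X Y ∈ M.covectors
  strong_elim : ∀ X ∈ M.covectors, ∀ Y ∈ M.covectors, ∀ e ∈ SignVec.sep X Y,
    ∃ Z ∈ M.covectors, Z e = 0 ∧ ∀ f ∉ SignVec.sep X Y, Z f = SignVec.comp X Y f
  neg_mem : ∀ X ∈ M.covectors, -X ∈ M.covectors

/-- The zero set `X⁰`, as a subset of the ground set. -/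
def zeroSet (M : SignSystem α) (X : α → SignType) : Finset α :=
  M.ground.filter fun e => X e = 0

/-- The support of `X`, as a subset of the ground set. -/
def supp (M : SignSystem α) (X : α → SignType) : Finset α :=
  M.ground.filter fun e => X e ≠ 0

/-- The deletion `M ∖ A = (U ∖ A, {X ∖ A | X ∈ 𝓛})`. -/
def delete (M : SignSystem α) (A : Finset α) : SignSystem α where
  ground := M.ground \ A
  covectors := (fun X => SignVec.delete X A) '' M.covectors
  eq_zero_of_notMem := by
    rintro _ ⟨X, hX, rfl⟩ e he
    by_cases hA : e ∈ A
    · simp [SignVec.delete, hA]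
    · have hg : e ∉ M.ground := fun h => he (Finset.mem_sdiff.2 ⟨h, hA⟩)
      simpa [SignVec.delete, hA] using M.eq_zero_of_notMem X hX e hg

/-- Topes: maximal covectors. -/
def IsTope (M : SignSystem α) (T : α → SignType) : Prop :=
  T ∈ M.covectors ∧ ∀ Y ∈ M.covectors, SignVec.Le T Y → Y = T

/-- Cocircuits: minimal nonzero covectors. -/
def IsCocircuit (M : SignSystem α) (X : α → SignType) : Prop :=
  X ∈ M.covectors ∧ X ≠ 0 ∧ ∀ Y ∈ M.covectors, Y ≠ 0 → SignVec.Le Y X → Y = X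

/-- `T T'` is an edge of the tope graph (the 1-inclusion graph of the set of topes) that lies in
the Θ-class `E_e`. -/
def IsEdge (M : SignSystem α) (e : α) (T T' : α → SignType) : Prop :=
  M.IsTope T ∧ M.IsTope T' ∧ SignVec.sep T T' = {e}

/-- `osc(H)`, for a set `H` of topes: the elements `e` such that no edge of `E_e` has both ends
in `H`, while some edge of `E_e` has exactly one end in `H`. -/
def osc (M : SignSystem α) (H : Set (α → SignType)) : Set α :=
  {e | e ∈ M.ground ∧ (¬ ∃ T ∈ H, ∃ T' ∈ H, M.IsEdge e T T') ∧
    ∃ T ∈ H, ∃ T' ∉ H, M.IsEdge e T T'}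

/-- The (vertex set of the) convex set `[S]`: all topes `T` with `S ≤ T`. -/
def cell (M : SignSystem α) (S : α → SignType) : Set (α → SignType) :=
  {T | M.IsTope T ∧ SignVec.Le S T}

open Classical in
/-- The topes as a family of subsets of the ground set: `T` corresponds to `{e | T e = +1}`. -/
noncomputable def topeFamily (M : SignSystem α) : Finset (Finset α) :=
  M.ground.powerset.filter fun A => ∃ T, M.IsTope T ∧ ∀ e, e ∈ A ↔ T e = 1

/-- `D` is shattered by (the topes of) `M`. -/
def Shatters (M : SignSystem α) (D : Finset α) : Prop := M.topeFamily.Shatters D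

/-- The VC-dimension of `M`, i.e. of its set of topes. -/
noncomputable def vcDim (M : SignSystem α) : ℕ := M.topeFamily.vcDim

/-- Realizable samples. -/
def IsSample (M : SignSystem α) (S : α → SignType) : Prop :=
  ∃ X ∈ M.covectors, SignVec.Le S X

/-- Full samples: realizable samples `S` such that contracting the Θ-classes of `S⁰` in the tope
graph (i.e. projecting all topes to `U ∖ S⁰`) does not change the VC-dimension. -/
def IsFull (M : SignSystem α) (S : α → SignType) : Prop :=
  M.IsSample S ∧ (M.topeFamily.image fun A => A \ M.zeroSet S).vcDim = M.vcDim

/-- The set of full samples of `M`, as a type. -/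
def FullSample (M : SignSystem α) : Type _ := {S : α → SignType // M.IsFull S}

/-- The cocircuits `X ≤ S` of `M` whose support contains `e`. -/
def lowerCocircuits (M : SignSystem α) (S : α → SignType) (e : α) : Set (α → SignType) :=
  {X | M.IsCocircuit X ∧ X e ≠ 0 ∧ SignVec.Le X S}

/-- `X` is the lexicographically minimal element of `C`. -/
def IsLexMin (C : Set (α → SignType)) (X : α → SignType) : Prop :=
  X ∈ C ∧ ∀ Y ∈ C, Y ≠ X → SignVec.LexLt X Y

open Classical in
/-- The recursively defined function `f_M`. For a full sample `S` that is not a tope,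
`f_M(S) = f_{M ∖ S⁰}(S ∖ S⁰)`. For a tope `S`, let `e` be the least element of `osc([S])` and `X`
the lexicographically minimal cocircuit with `X ≤ S` and `X e ≠ 0`; then
`f_M(S) = {e} ∪ f_{M(X)}(S ∖ supp X)`, where `M(X) = M ∖ supp X`. If no such `e`, `X` exist, the
value is `∅`. (A realizable sample without zeros on the ground set is a tope, so that the last
branch is never reached from a full sample.) -/
noncomputable def distinguish (M : SignSystem α) (S : α → SignType) : Finset α :=
  if M.IsTope S then
    if h : ∃ p : α × (α → SignType),
        IsLeast (M.osc (M.cell S)) p.1 ∧ IsLexMin (M.lowerCocircuits S p.1) p.2 then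
      insert h.choose.1 (distinguish (M.delete (M.supp h.choose.2))
        (SignVec.delete S (M.supp h.choose.2)))
    else ∅
  else if h0 : (M.zeroSet S).Nonempty then
    distinguish (M.delete (M.zeroSet S)) (SignVec.delete S (M.zeroSet S))
  else ∅
termination_by M.ground.card
decreasing_by
  · have hp := h.choose_spec
    exact Finset.card_lt_card (Finset.sdiff_ssubset (Finset.filter_subset _ _)
      ⟨h.choose.1, Finset.mem_filter.2 ⟨hp.1.1.1, hp.2.1.2.1⟩⟩)
  · exact Finset.card_lt_card (Finset.sdiff_ssubset (Finset.filter_subset _ _) h0)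

/-- Equivalence of full samples: `f_M(S) = f_M(S')`, and `S`, `S'` agree on this set. -/
def fullSampleSetoid (M : SignSystem α) : Setoid M.FullSample where
  r S S' := M.distinguish S.1 = M.distinguish S'.1 ∧
    ∀ e ∈ M.distinguish S.1, S.1 e = S'.1 e
  iseqv :=
    { refl := fun _ => ⟨rfl, fun _ _ => rfl⟩
      symm := fun h => ⟨h.1.symm, fun e he => (h.2 e (h.1 ▸ he)).symm⟩
      trans := fun h h' => ⟨h.1.trans h'.1,
        fun e he => (h.2 e he).trans (h'.2 e (h.1 ▸ he))⟩ }

end SignSystem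

/-! ### Signs and sign vectors -/

namespace SignVec

variable {α : Type*}

/-! Shattered sets behave as the independent sets of the underlying matroid, and the VC-dimension as
its rank. On a shattered set every sign pattern, zeros included, is realized by a covector
(`exists_extension`), and a covector vanishing on a shattered `D` but not at `g` makes `insert g D`
shattered (`shatters_insert`). The zero set of a cocircuit has corank one (`vcDim_delete_supp`), so
each tope step of the recursion adds one element and lowers the rank by one; the result is a basis.

Membership in `osc` has a local test (`mem_osc_cell`): some covector vanishes at `e` and agrees with
`S` on the rest of its support. Composing the chosen cocircuit `X ≤ S` with such a covector of the
deletion lifts the test back to `M`, which gives (i).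

For (iii), `D` and the signs on it must determine enough of the recursion. Since `e_S` is least in
`osc([S])` and `D` lies in `osc([S])`, it is the minimum of `D`. The cocircuit used vanishes on the
rest of the basis `D`, so it is determined by its sign at `e_S` (`eq_of_basis`). A covector `V` of
`M` with this sign at `e_S` and zeros on the rest of `D` therefore restricts to that cocircuit for
every sample in the class. After deleting the support of `V`, induction supplies a common tope, and
composing with `V` lifts it to `M`. -/

theorem mul_eq_neg_one_iff (a b : SignType) : a * b = -1 ↔ a ≠ 0 ∧ b = -a := by
  decide +revert

theorem eq_neg_of_ne {a b : SignType} (ha : a ≠ 0) (hb : b ≠ 0) (h : a ≠ b) : b = -a := by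
  decide +revert

theorem ne_neg_self {a : SignType} (ha : a ≠ 0) : a ≠ -a := by
  decide +revert

theorem lexPos_injective : Function.Injective lexPos := by
  intro a b; decide +revert

theorem mem_sep {X Y : α → SignType} {e : α} : e ∈ sep X Y ↔ X e ≠ 0 ∧ Y e = -X e :=
  mul_eq_neg_one_iff _ _

theorem comp_of_eq {X : α → SignType} (Y : α → SignType) {e : α} (h : X e = 0) :
    comp X Y e = Y e := if_pos h

theorem comp_of_ne {X : α → SignType} (Y : α → SignType) {e : α} (h : X e ≠ 0) :
    comp X Y e = X e := if_neg h

theorem comp_ne_zero {X Y : α → SignType} {e : α} (h : X e ≠ 0 ∨ Y e ≠ 0) : comp X Y e ≠ 0 := by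
  unfold comp; split_ifs with h0
  · exact h.resolve_left (not_not.2 h0)
  · exact h0

theorem Le.refl (X : α → SignType) : Le X X := fun _ _ => rfl

theorem Le.trans {X Y Z : α → SignType} (h : Le X Y) (h' : Le Y Z) : Le X Z := fun e he =>
  (h e he).trans (h' e (h e he ▸ he))

variable [DecidableEq α]

theorem delete_of_mem (X : α → SignType) {A : Finset α} {e : α} (h : e ∈ A) :
    delete X A e = 0 := if_pos h

theorem delete_of_notMem (X : α → SignType) {A : Finset α} {e : α} (h : e ∉ A) :
    delete X A e = X e := if_neg h

theorem delete_delete (X : α → SignType) (A B : Finset α) :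
    delete (delete X A) B = delete X (A ∪ B) := by
  funext e
  by_cases hA : e ∈ A <;> by_cases hB : e ∈ B <;> simp [delete, hA, hB]

end SignVec

/-! ### Deletion in sign systems -/

namespace SignSystem

open SignVec

variable {α : Type*} [LinearOrder α] {M : SignSystem α}

theorem ext_of_eq {M N : SignSystem α} (h : M.ground = N.ground)
    (h' : M.covectors = N.covectors) : M = N := by
  cases M; cases N; cases h; cases h'; rfl

theorem delete_delete (M : SignSystem α) (A B : Finset α) :
    (M.delete A).delete B = M.delete (A ∪ B) := by
  refine ext_of_eq (sdiff_sdiff_left) ?_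
  change (fun X => SignVec.delete X B) '' ((fun X => SignVec.delete X A) '' M.covectors) =
    (fun X => SignVec.delete X (A ∪ B)) '' M.covectors
  rw [Set.image_image]
  simp only [SignVec.delete_delete]

theorem mem_ground_of_ne_zero {X : α → SignType} (hX : X ∈ M.covectors) {e : α} (h : X e ≠ 0) :
    e ∈ M.ground := by
  by_contra he
  exact h (M.eq_zero_of_notMem X hX e he)

theorem mem_ground_delete {A : Finset α} {e : α} :
    e ∈ (M.delete A).ground ↔ e ∈ M.ground ∧ e ∉ A := Finset.mem_sdiff

theorem delete_mem_covectors (A : Finset α) {X : α → SignType} (hX : X ∈ M.covectors) :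
    SignVec.delete X A ∈ (M.delete A).covectors := ⟨X, hX, rfl⟩

theorem mem_supp {X : α → SignType} (hX : X ∈ M.covectors) {e : α} : e ∈ M.supp X ↔ X e ≠ 0 := by
  simp only [supp, Finset.mem_filter, and_iff_right_iff_imp]
  exact mem_ground_of_ne_zero hX

/-! ### Covectors and topes of an oriented matroid -/

namespace IsOM

theorem delete (hM : M.IsOM) (A : Finset α) : (M.delete A).IsOM where
  simple :=
    { all_signs := by
        intro e he s
        rw [mem_ground_delete] at he
        obtain ⟨X, hX, h⟩ := hM.simple.all_signs e he.1 s
        exact ⟨_, delete_mem_covectors A hX, by rwa [delete_of_notMem _ he.2]⟩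
      not_parallel := by
        intro e he f hf hef
        rw [mem_ground_delete] at he hf
        obtain ⟨X, hX, Y, hY, h⟩ := hM.simple.not_parallel e he.1 f hf.1 hef
        refine ⟨_, delete_mem_covectors A hX, _, delete_mem_covectors A hY, ?_⟩
        simpa only [delete_of_notMem _ he.2, delete_of_notMem _ hf.2] using h }
  zero_mem := ⟨0, hM.zero_mem, by funext e; simp [SignVec.delete]⟩
  comp_mem := by
    rintro _ ⟨X, hX, rfl⟩ _ ⟨Y, hY, rfl⟩
    refine ⟨_, hM.comp_mem X hX Y hY, ?_⟩
    funext e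
    by_cases hA : e ∈ A <;> simp [SignVec.delete, comp, hA]
  strong_elim := by
    rintro _ ⟨X, hX, rfl⟩ _ ⟨Y, hY, rfl⟩ e he
    have heA : e ∉ A := by
      intro h
      exact (mem_sep.1 he).1 (delete_of_mem X h)
    have hs : ∀ f ∉ A, (f ∈ sep X Y ↔ f ∈ sep (SignVec.delete X A) (SignVec.delete Y A)) := by
      intro f hf
      rw [mem_sep, mem_sep, delete_of_notMem _ hf, delete_of_notMem _ hf]
    obtain ⟨Z, hZ, h0, h⟩ := hM.strong_elim X hX Y hY e ((hs e heA).2 he)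
    refine ⟨_, delete_mem_covectors A hZ, by rwa [delete_of_notMem _ heA], fun f hf => ?_⟩
    by_cases hA : f ∈ A
    · simp [SignVec.delete, comp, hA]
    · rw [delete_of_notMem _ hA, h f (fun h' => hf ((hs f hA).1 h'))]
      simp [SignVec.delete, comp, hA]
  neg_mem := by
    rintro _ ⟨X, hX, rfl⟩
    refine ⟨_, hM.neg_mem X hX, ?_⟩
    funext e
    by_cases hA : e ∈ A <;> simp [SignVec.delete, hA]

/-- Finitely many covectors of a composition-closed set `C` can be composed to one that is nonzero
wherever one of them is. -/
theorem exists_ne_zero_on (C : Set (α → SignType)) (h0 : (0 : α → SignType) ∈ C)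
    (hC : ∀ X ∈ C, ∀ Y ∈ C, comp X Y ∈ C) (B : Finset α) (hB : ∀ f ∈ B, ∃ W ∈ C, W f ≠ 0) :
    ∃ W ∈ C, ∀ f ∈ B, W f ≠ 0 := by
  induction B using Finset.induction_on with
  | empty => exact ⟨0, h0, by simp⟩
  | insert f B _ ih =>
    obtain ⟨W, hW, h⟩ := ih fun g hg => hB g (Finset.mem_insert_of_mem hg)
    obtain ⟨V, hV, hf⟩ := hB f (Finset.mem_insert_self _ _)
    refine ⟨_, hC W hW V hV, fun g hg => comp_ne_zero ?_⟩
    rcases Finset.mem_insert.1 hg with rfl | hg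
    · exact Or.inr hf
    · exact Or.inl (h g hg)

theorem exists_full (hM : M.IsOM) : ∃ T ∈ M.covectors, ∀ e ∈ M.ground, T e ≠ 0 := by
  refine exists_ne_zero_on M.covectors hM.zero_mem hM.comp_mem _ fun f hf => ?_
  obtain ⟨X, hX, h⟩ := hM.simple.all_signs f hf 1
  exact ⟨X, hX, by rw [h]; decide⟩

theorem isTope_iff (hM : M.IsOM) {T : α → SignType} :
    M.IsTope T ↔ T ∈ M.covectors ∧ ∀ e ∈ M.ground, T e ≠ 0 := by
  refine and_congr_right fun hT => ⟨fun h e he h0 => ?_, fun h Y hY hle => ?_⟩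
  · obtain ⟨X, hX, hn⟩ := hM.exists_full
    have := h _ (hM.comp_mem T hT X hX) fun f hf => (comp_of_ne _ hf).symm
    have h1 := congrFun this e
    rw [comp_of_eq _ h0, h0] at h1
    exact hn e he h1
  · funext e
    by_cases he : e ∈ M.ground
    · exact (hle e (h e he)).symm
    · rw [M.eq_zero_of_notMem _ hY e he, M.eq_zero_of_notMem _ hT e he]

theorem exists_isTope (hM : M.IsOM) : ∃ T, M.IsTope T :=
  let ⟨T, h⟩ := hM.exists_full
  ⟨T, hM.isTope_iff.2 h⟩

theorem exists_isTope_ge (hM : M.IsOM) {X : α → SignType} (hX : X ∈ M.covectors) :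
    ∃ T, M.IsTope T ∧ Le X T := by
  obtain ⟨T, hT, h⟩ := hM.exists_full
  exact ⟨comp X T, hM.isTope_iff.2 ⟨hM.comp_mem X hX T hT, fun e he => comp_ne_zero (.inr (h e he))⟩,
    fun e he => (comp_of_ne _ he).symm⟩

theorem exists_sign (hM : M.IsOM) {e : α} {Y : α → SignType} (hY : Y ∈ M.covectors) (he : Y e ≠ 0)
    {s : SignType} (hs : s ≠ 0) :
    ∃ Z ∈ M.covectors, Z e = s ∧ ∀ f, Y f = 0 ↔ Z f = 0 := by
  by_cases h : s = Y e
  · exact ⟨Y, hY, h.symm, fun _ => Iff.rfl⟩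
  · refine ⟨-Y, hM.neg_mem Y hY, (eq_neg_of_ne he hs (Ne.symm h)).symm, fun f => ?_⟩
    rw [Pi.neg_apply]
    generalize Y f = a
    decide +revert

/-- If `X` has equal signs at `e`, `f` and `Y` opposite ones, then one of `Y`, `-Y` is separated
from `X` at `e` but not at `f`; eliminating `e` keeps the sign at `f`. -/
theorem exists_separating (hM : M.IsOM) {e f : α} (he : e ∈ M.ground) (hf : f ∈ M.ground) (hef : e ≠ f) :
    ∃ Z ∈ M.covectors, Z e = 0 ∧ Z f ≠ 0 := by
  obtain ⟨X, hX, Y, hY, h1, h2⟩ := hM.simple.not_parallel e he f hf hef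
  have key : ∀ a b c d : SignType, a * b = 1 → c * d = -1 →
      (a * c = -1 ∧ b ≠ 0 ∧ b * d ≠ -1) ∨ (a * -c = -1 ∧ b ≠ 0 ∧ b * -d ≠ -1) := by decide
  rcases key _ _ _ _ h1 h2 with ⟨h, hb, hn⟩ | ⟨h, hb, hn⟩
  · obtain ⟨Z, hZ, h0, hz⟩ := hM.strong_elim X hX Y hY e h
    exact ⟨Z, hZ, h0, by rwa [hz f hn, comp_of_ne _ hb]⟩
  · obtain ⟨Z, hZ, h0, hz⟩ := hM.strong_elim X hX (-Y) (hM.neg_mem Y hY) e h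
    exact ⟨Z, hZ, h0, by rwa [hz f hn, comp_of_ne _ hb]⟩

theorem exists_zero_only (hM : M.IsOM) {e : α} (he : e ∈ M.ground) :
    ∃ W ∈ M.covectors, W e = 0 ∧ ∀ f ∈ M.ground, f ≠ e → W f ≠ 0 := by
  obtain ⟨W, hW, h⟩ := exists_ne_zero_on {X | X ∈ M.covectors ∧ X e = 0} ⟨hM.zero_mem, rfl⟩
    (fun X hX Y hY => ⟨hM.comp_mem X hX.1 Y hY.1, (comp_of_eq _ hX.2).trans hY.2⟩)
    (M.ground.erase e) fun f hf => by
      obtain ⟨Z, hZ, h0, hz⟩ := hM.exists_separating he (Finset.mem_of_mem_erase hf)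
        (Finset.ne_of_mem_erase hf).symm
      exact ⟨Z, ⟨hZ, h0⟩, hz⟩
  exact ⟨W, hW.1, hW.2, fun f hf hfe => h f (Finset.mem_erase.2 ⟨hfe, hf⟩)⟩

/-! ### A covector criterion for `osc` -/

/-- An edge leaving the cell yields `Z` by eliminating `e` between its ends. Conversely, `Z` is made
nonzero off `e` by composition with a covector vanishing only at `e`; the two ways of filling in the
sign at `e` are the ends of an edge. No edge of this class lies inside the cell, since `S e ≠ 0`
fixes that sign. -/
theorem mem_osc_cell (hM : M.IsOM) {S : α → SignType} (hS : M.IsSample S) {e : α} :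
    e ∈ M.osc (M.cell S) ↔
      S e ≠ 0 ∧ ∃ Z ∈ M.covectors, Z e = 0 ∧ ∀ f, f ≠ e → S f ≠ 0 → Z f = S f := by
  constructor
  · rintro ⟨-, -, T, hT, T', hT', -, hTt, hsep⟩
    have hT'S : ¬ Le S T' := fun h => hT' ⟨hTt, h⟩
    have hT1 := hM.isTope_iff.1 hT.1
    have hT1' := hM.isTope_iff.1 hTt
    simp only [Le, not_forall] at hT'S
    obtain ⟨f, hf, hne⟩ := hT'S
    have hfT := hT.2 f hf
    have hTf : T f ≠ 0 := hfT ▸ hf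
    have hfe : f ∈ sep T T' := mem_sep.2 ⟨hTf, eq_neg_of_ne hTf
      (hT1'.2 f (mem_ground_of_ne_zero hT1.1 hTf)) (hfT ▸ hne)⟩
    have hfe' := hfe
    rw [hsep, Set.mem_singleton_iff] at hfe'
    subst hfe'
    obtain ⟨Z, hZ, h0, h⟩ := hM.strong_elim T hT1.1 T' hT1'.1 f hfe
    refine ⟨hf, Z, hZ, h0, fun g hg hgS => ?_⟩
    rw [h g (by rwa [hsep]), hT.2 g hgS, comp_of_ne]
    exact hT.2 g hgS ▸ hgS
  · rintro ⟨he, Z, hZ, h0, h⟩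
    obtain ⟨X, hX, hSX⟩ := hS
    have heg : e ∈ M.ground := mem_ground_of_ne_zero hX (hSX e he ▸ he)
    obtain ⟨W, hW, hW0, hWn⟩ := hM.exists_zero_only heg
    set V := comp Z W with hV
    have hVm : V ∈ M.covectors := hM.comp_mem Z hZ W hW
    have hV0 : V e = 0 := by rw [hV, comp_of_eq _ h0, hW0]
    have hVn : ∀ f ∈ M.ground, f ≠ e → V f ≠ 0 := fun f hf hfe => comp_ne_zero (.inr (hWn f hf hfe))
    have hVS : ∀ f, f ≠ e → S f ≠ 0 → V f = S f := fun f hfe hf => by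
      rw [hV, comp_of_ne _ (by rw [h f hfe hf]; exact hf), h f hfe hf]
    have htope : ∀ Y ∈ M.covectors, Y e ≠ 0 → M.IsTope (comp V Y) := fun Y hY hYe =>
      hM.isTope_iff.2 ⟨hM.comp_mem V hVm Y hY, fun f hf => comp_ne_zero <| by
        by_cases hfe : f = e
        · exact .inr (hfe ▸ hYe)
        · exact .inl (hVn f hf hfe)⟩
    have hXe : X e ≠ 0 := hSX e he ▸ he
    have hXe' : (-X) e ≠ 0 := by
      rw [Pi.neg_apply]; revert hXe; generalize X e = a; decide +revert
    refine ⟨heg, ?_, comp V X, ⟨htope X hX hXe, fun f hf => ?_⟩, comp V (-X), ?_,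
      htope X hX hXe, htope _ (hM.neg_mem X hX) hXe', ?_⟩
    · rintro ⟨T, hT, T', hT', -, -, hs⟩
      have : e ∈ sep T T' := hs ▸ rfl
      rw [mem_sep, ← hT.2 e he, ← hT'.2 e he] at this
      exact ne_neg_self he this.2
    · by_cases hfe : f = e
      · rw [hfe, comp_of_eq _ hV0, hSX e he]
      · rw [comp_of_ne _ (by rw [hVS f hfe hf]; exact hf), hVS f hfe hf]
    · rintro ⟨-, hle⟩
      have := hle e he
      rw [comp_of_eq _ hV0, Pi.neg_apply, ← hSX e he] at this
      exact ne_neg_self he this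
    · ext f
      rw [mem_sep, Set.mem_singleton_iff]
      constructor
      · rintro ⟨h1, h2⟩
        by_contra hfe
        by_cases hVf : V f = 0
        · have hf : f ∉ M.ground := fun hf => hVn f hf hfe hVf
          rw [comp_of_eq _ hVf, M.eq_zero_of_notMem X hX f hf] at h1
          exact h1 rfl
        · rw [comp_of_ne _ hVf, comp_of_ne _ hVf] at h2
          exact ne_neg_self hVf h2
      · rintro rfl
        rw [comp_of_eq _ hV0, comp_of_eq _ hV0]
        exact ⟨hXe, rfl⟩

/-! ### Elimination and cocircuits -/

open Classical in
/-- Repeated elimination of `X` against a covector `Z ≠ X` with smaller support. -/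
theorem exists_lt (hM : M.IsOM) {X : α → SignType} (hX : X ∈ M.covectors) (n : ℕ) :
    ∀ Z ∈ M.covectors, (M.ground.filter fun f => f ∈ sep X Z).card ≤ n →
    (∀ f, X f = 0 → Z f = 0) → Z ≠ X →
    ∃ Z' ∈ M.covectors, Le Z' X ∧ Z' ≠ X ∧ ∀ f, Z f = X f → Z' f = X f := by
  induction n with
  | zero =>
    intro Z hZ hn hs hne
    refine ⟨Z, hZ, fun f hf => ?_, hne, fun _ h => h⟩
    by_contra hfn
    have hfg := mem_ground_of_ne_zero hZ hf
    have hXf : X f ≠ 0 := fun h => hf (hs f h)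
    rw [Nat.le_zero, Finset.card_eq_zero] at hn
    have : f ∈ M.ground.filter fun f => f ∈ sep X Z :=
      Finset.mem_filter.2 ⟨hfg, mem_sep.2 ⟨hXf, eq_neg_of_ne hXf hf (Ne.symm hfn)⟩⟩
    simp [hn] at this
  | succ n ih =>
    intro Z hZ hn hs hne
    by_cases hg : ∃ g, g ∈ sep X Z
    · obtain ⟨g, hg⟩ := hg
      obtain ⟨Y, hY, h0, h⟩ := hM.strong_elim X hX Z hZ g hg
      have hXY : ∀ f, f ∉ sep X Z → Y f = X f := fun f hf => by
        rw [h f hf]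
        by_cases hXf : X f = 0
        · rw [comp_of_eq _ hXf, hs f hXf, hXf]
        · rw [comp_of_ne _ hXf]
      -- The separator shrinks strictly: `Y` agrees with `X` off the old one and vanishes at `g`.
      have hcard : (M.ground.filter fun f => f ∈ sep X Y).card ≤ n := by
        refine Nat.le_of_lt_succ (lt_of_lt_of_le (Finset.card_lt_card ?_) hn)
        refine Finset.ssubset_iff_subset_ne.2 ⟨fun f hf => ?_, fun heq => ?_⟩
        · rw [Finset.mem_filter] at hf ⊢
          refine ⟨hf.1, by_contra fun hfs => ?_⟩
          have := mem_sep.1 hf.2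
          rw [hXY f hfs] at this
          exact ne_neg_self this.1 this.2
        · have : g ∈ M.ground.filter fun f => f ∈ sep X Z :=
            Finset.mem_filter.2 ⟨mem_ground_of_ne_zero hX (mem_sep.1 hg).1, hg⟩
          rw [← heq, Finset.mem_filter, mem_sep, h0] at this
          have h2 := this.2
          revert h2; generalize X g = a; decide +revert
      obtain ⟨Z', hZ', hle, hne', hag⟩ := ih Y hY hcard
        (fun f hf => by rw [hXY f (fun h => (mem_sep.1 h).1 hf), hf])
        (fun heq => (mem_sep.1 hg).1 (heq ▸ h0))
      refine ⟨Z', hZ', hle, hne', fun f hf => hag f (hXY f fun hfs => ?_)⟩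
      rw [mem_sep, hf] at hfs
      exact ne_neg_self hfs.1 hfs.2
    · refine ih Z hZ ?_ hs hne
      rw [Finset.filter_false_of_mem fun f _ hf => hg ⟨f, hf⟩]
      simp

open Classical in
theorem exists_le_of_support (hM : M.IsOM) {X Z : α → SignType} (hX : X ∈ M.covectors) (hZ : Z ∈ M.covectors)
    (hs : ∀ f, X f = 0 → Z f = 0) (hne : Z ≠ X) :
    ∃ Z' ∈ M.covectors, Le Z' X ∧ Z' ≠ X ∧ ∀ f, Z f = X f → Z' f = X f :=
  hM.exists_lt hX _ Z hZ le_rfl hs hne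

/-- Cocircuits have minimal support. -/
theorem ne_zero_of_isCocircuit (hM : M.IsOM) {X Y : α → SignType} (hX : M.IsCocircuit X) (hY : Y ∈ M.covectors)
    (hs : ∀ f, X f = 0 → Y f = 0) {a : α} (ha : Y a ≠ 0) {b : α} (hb : X b ≠ 0) : Y b ≠ 0 := by
  intro hYb
  have hXa : X a ≠ 0 := fun h => ha (hs a h)
  obtain ⟨Z, hZ, hZa, hz⟩ := hM.exists_sign hY ha hXa
  obtain ⟨Z', hZ', hle, hne, hag⟩ := hM.exists_le_of_support hX.1 hZ
    (fun f hf => (hz f).1 (hs f hf)) (fun h => hb (h ▸ (hz b).1 hYb))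
  refine hne (hX.2.2 Z' hZ' (fun h => ?_) hle)
  have := hag a hZa
  rw [h] at this
  exact hXa this.symm

theorem finite_covectors (M : SignSystem α) : M.covectors.Finite := by
  refine Set.Finite.of_finite_image (f := fun X (i : M.ground) => X i) (Set.toFinite _) ?_
  intro X hX Y hY h
  funext e
  by_cases he : e ∈ M.ground
  · exact congrFun h ⟨e, he⟩
  · rw [M.eq_zero_of_notMem X hX e he, M.eq_zero_of_notMem Y hY e he]

/-- A covector `X ≤ S` of least support among those nonzero at `e` is a cocircuit: a nonzero
covector `Y ≤ X`, `Y ≠ X`, would vanish at `e`, and eliminating between `X` and `-Y` would give a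
smaller covector still nonzero at `e`. -/
theorem exists_lowerCocircuit (hM : M.IsOM) {S : α → SignType} (hS : S ∈ M.covectors) {e : α} (he : S e ≠ 0) :
    (M.lowerCocircuits S e).Nonempty := by
  let C := {X | X ∈ M.covectors ∧ Le X S ∧ X e ≠ 0}
  obtain ⟨X, ⟨hX, hXS, hXe⟩, hmin⟩ := Set.exists_min_image C (fun X => (M.supp X).card)
    ((finite_covectors M).subset fun X h => h.1) ⟨S, hS, Le.refl S, he⟩
  have hmin' : ∀ Y ∈ M.covectors, Le Y X → Y e ≠ 0 → Y = X := by
    intro Y hY hle hYe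
    have hsub : M.supp Y ⊆ M.supp X := fun f hf => by
      rw [mem_supp hY] at hf
      rw [mem_supp hX, ← hle f hf]
      exact hf
    have := Finset.eq_of_subset_of_card_le hsub (hmin Y ⟨hY, hle.trans hXS, hYe⟩)
    funext f
    by_cases hf : Y f = 0
    · rw [hf]
      by_contra hXf
      have h2 := (mem_supp hX).2 (Ne.symm hXf)
      rw [← this, mem_supp hY] at h2
      exact h2 hf
    · exact hle f hf
  refine ⟨X, ⟨hX, fun h => hXe (by rw [h]; rfl), fun Y hY hY0 hle => ?_⟩, hXe, hXS⟩
  by_contra hne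
  have hYe : Y e = 0 := by_contra fun h => hne (hmin' Y hY hle h)
  obtain ⟨f, hf⟩ : ∃ f, Y f ≠ 0 := by
    by_contra! h
    exact hY0 (funext h)
  have hsep : ∀ g, g ∈ sep X (-Y) ↔ Y g ≠ 0 := fun g => by
    rw [mem_sep, Pi.neg_apply]
    refine ⟨fun h hg => ?_, fun h => ⟨hle g h ▸ h, by rw [hle g h]⟩⟩
    have h1 := h.1
    have h2 := h.2
    rw [hg] at h2
    revert h1 h2; generalize X g = a; decide +revert
  obtain ⟨Z, hZ, h0, h⟩ := hM.strong_elim X hX (-Y) (hM.neg_mem Y hY) f ((hsep f).2 hf)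
  have hXf : X f ≠ 0 := hle f hf ▸ hf
  have hsupp : ∀ g, X g = 0 → Z g = 0 := fun g hg => by
    have hYg : Y g = 0 := by_contra fun h => h ((hle g h).trans hg)
    rw [h g (by rw [hsep]; exact not_not.2 hYg), comp_of_eq _ hg, Pi.neg_apply, hYg]
    decide
  obtain ⟨Z', hZ', hle', hne', hag⟩ := hM.exists_le_of_support hX hZ hsupp (fun h => hXf (h ▸ h0))
  refine hne' (hmin' Z' hZ' hle' ?_)
  rw [hag e]
  · exact hXe
  · rw [h e (by rw [hsep]; exact not_not.2 hYe), comp_of_ne _ hXe]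

theorem exists_isLexMin {C : Set (α → SignType)} (hC : C ⊆ M.covectors) (hne : C.Nonempty) :
    ∃ X, IsLexMin C X := by
  let φ : (α → SignType) → Lex (M.ground → ℕ) := fun X => toLex fun i => lexPos (X i)
  obtain ⟨X, hX, hmin⟩ := Set.exists_min_image C φ ((finite_covectors M).subset hC) hne
  refine ⟨X, hX, fun Y hY hYX => ?_⟩
  have hlt : φ X < φ Y := by
    refine lt_of_le_of_ne (hmin Y hY) fun h => hYX ?_
    funext e
    by_cases he : e ∈ M.ground
    · exact (lexPos_injective (congrFun (congrArg ofLex h) ⟨e, he⟩)).symm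
    · rw [M.eq_zero_of_notMem X (hC hX) e he, M.eq_zero_of_notMem Y (hC hY) e he]
  obtain ⟨i, hi, hlt⟩ := hlt
  refine ⟨i, fun e' he' => ?_, hlt⟩
  by_cases he : e' ∈ M.ground
  · exact lexPos_injective (hi ⟨e', he⟩ he')
  · rw [M.eq_zero_of_notMem X (hC hX) e' he, M.eq_zero_of_notMem Y (hC hY) e' he]

/-! ### Facets of topes -/

/-- Every tope of a nonempty simple oriented matroid has a facet. -/
theorem osc_cell_nonempty (hM : M.IsOM) {S : α → SignType} (hS : M.IsTope S) (hU : M.ground.Nonempty) :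
    (M.osc (M.cell S)).Nonempty := by
  obtain ⟨hSc, hSn⟩ := hM.isTope_iff.1 hS
  let C := {T | M.IsTope T ∧ T ≠ S}
  have hneg : -S ∈ C := by
    refine ⟨hM.isTope_iff.2 ⟨hM.neg_mem S hSc, fun e he => ?_⟩, fun h => ?_⟩
    · have := hSn e he
      rw [Pi.neg_apply]
      revert this; generalize S e = a; decide +revert
    · obtain ⟨e, he⟩ := hU
      exact ne_neg_self (hSn e he) (congrFun h e).symm
  -- `T` is a nearest tope to `S` other than `S`; any `e` where they differ will be a facet.
  obtain ⟨T, ⟨hT, hTS⟩, hmin⟩ := Set.exists_min_image C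
    (fun T => (M.ground.filter fun f => T f ≠ S f).card)
    ((finite_covectors M).subset fun T h => h.1.1) ⟨_, hneg⟩
  obtain ⟨hTc, hTn⟩ := hM.isTope_iff.1 hT
  have hmin' : ∀ Y, M.IsTope Y → (∀ f, T f = S f → Y f = S f) → Y ≠ S →
      ∀ f, Y f = S f → T f = S f := by
    intro Y hY hsub hne f hf
    by_contra hTf
    have hfg : f ∈ M.ground := by
      by_contra hfg
      rw [M.eq_zero_of_notMem T hTc f hfg, M.eq_zero_of_notMem S hSc f hfg] at hTf
      exact hTf rfl
    have hss : (M.ground.filter fun f => Y f ≠ S f) ⊆ M.ground.filter fun f => T f ≠ S f :=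
      fun g hg => by
        rw [Finset.mem_filter] at hg ⊢
        exact ⟨hg.1, fun h => hg.2 (hsub g h)⟩
    have := Finset.eq_of_subset_of_card_le hss (hmin Y ⟨hY, hne⟩)
    have h2 : f ∈ M.ground.filter fun f => T f ≠ S f := Finset.mem_filter.2 ⟨hfg, hTf⟩
    rw [← this, Finset.mem_filter] at h2
    exact h2.2 hf
  obtain ⟨e, he⟩ : ∃ e, T e ≠ S e := by
    by_contra! h
    exact hTS (funext h)
  have heg : e ∈ M.ground := by
    by_contra hfg
    rw [M.eq_zero_of_notMem T hTc e hfg, M.eq_zero_of_notMem S hSc e hfg] at he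
    exact he rfl
  have hne_sep : ∀ f, T f = S f → f ∉ sep S T := fun f hf hs => by
    rw [mem_sep, hf] at hs
    exact ne_neg_self hs.1 hs.2
  obtain ⟨Z, hZ, hZ0, hz⟩ := hM.strong_elim S hSc T hTc e
    (mem_sep.2 ⟨hSn e heg, eq_neg_of_ne (hSn e heg) (hTn e heg) he.symm⟩)
  have hZS : ∀ f, T f = S f → Z f = S f := fun f hf => by
    rw [hz f (hne_sep f hf)]
    by_cases h0 : S f = 0
    · rw [comp_of_eq _ h0, hf]
    · rw [comp_of_ne _ h0]
  have htope : ∀ Y ∈ M.covectors, (∀ f, T f = S f → Y f = S f) → ∀ R, M.IsTope R →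
      M.IsTope (comp Y R) := fun Y hY _ R hR =>
    hM.isTope_iff.2 ⟨hM.comp_mem Y hY R hR.1, fun f hf =>
      comp_ne_zero (.inr ((hM.isTope_iff.1 hR).2 f hf))⟩
  have hbetween : ∀ Y ∈ M.covectors, (∀ f, T f = S f → Y f = S f) → Y e = 0 →
      ∀ f, Y f ≠ 0 → Y f = S f → T f = S f := by
    intro Y hY hag h0 f hf hfS
    refine hmin' (comp Y T) (htope Y hY hag T hT) (fun g hg => ?_) (fun h => ?_) f ?_
    · by_cases hYg : Y g = 0
      · rw [comp_of_eq _ hYg, hg]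
      · rw [comp_of_ne _ hYg, hag g hg]
    · apply he
      rw [← congrFun h e, comp_of_eq _ h0]
    · rw [comp_of_ne _ hf, hfS]
  refine ⟨e, (hM.mem_osc_cell ⟨S, hSc, Le.refl S⟩).2 ⟨hSn e heg, Z, hZ, hZ0, fun f hfe hf => ?_⟩⟩
  by_contra hZf
  have hTf : T f ≠ S f := fun h => hZf (hZS f h)
  have hfg := mem_ground_of_ne_zero hSc hf
  -- If `Z f = 0`, set the sign at `f` to `S f` while keeping `e` at zero; completing by `T` then
  -- beats `T`. Otherwise `Z` has the wrong sign at `f`, and completing `Z` by `S` repairs `e`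
  -- without reaching `S`.
  by_cases hZf0 : Z f = 0
  · obtain ⟨W, hW, hWe, hWf⟩ := hM.exists_separating heg hfg hfe.symm
    obtain ⟨V, hV, hVf, hv⟩ := hM.exists_sign hW hWf hf
    refine hTf (hbetween (comp Z V) (hM.comp_mem Z hZ V hV) (fun g hg => ?_) ?_ f ?_ ?_)
    · by_cases hg0 : S g = 0
      · have : g ∉ M.ground := fun h => hSn g h hg0
        rw [M.eq_zero_of_notMem _ (hM.comp_mem Z hZ V hV) g this, hg0]
      · rw [comp_of_ne _ (by rw [hZS g hg]; exact hg0), hZS g hg]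
    · rw [comp_of_eq _ hZ0, ← hv e, hWe]
    · rw [comp_of_eq _ hZf0, hVf]; exact hf
    · rw [comp_of_eq _ hZf0, hVf]
  · refine he (hmin' (comp Z S) (htope Z hZ hZS S hS) (fun g hg => ?_) (fun h => hZf ?_) e ?_)
    · by_cases hZg : Z g = 0
      · rw [comp_of_eq _ hZg]
      · rw [comp_of_ne _ hZg, hZS g hg]
    · rw [← comp_of_ne S hZf0, h]
    · rw [comp_of_eq _ hZ0]

end IsOM

/-! ### Samples, zero sets and the tope family -/

theorem zero_of_mem_zeroSet {S : α → SignType} {e : α} (h : e ∈ M.zeroSet S) : S e = 0 :=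
  (Finset.mem_filter.1 h).2

theorem delete_zeroSet (M : SignSystem α) (S : α → SignType) :
    SignVec.delete S (M.zeroSet S) = S := by
  funext e
  by_cases h : e ∈ M.zeroSet S
  · rw [delete_of_mem _ h, zero_of_mem_zeroSet h]
  · rw [delete_of_notMem _ h]

theorem IsSample.mem_ground {S : α → SignType} (hS : M.IsSample S) {e : α} (h : S e ≠ 0) :
    e ∈ M.ground := by
  obtain ⟨X, hX, hle⟩ := hS
  exact mem_ground_of_ne_zero hX (hle e h ▸ h)

theorem mem_zeroSet {S : α → SignType} {e : α} (he : e ∈ M.ground) :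
    e ∈ M.zeroSet S ↔ S e = 0 := by
  simp [zeroSet, he]

theorem IsSample.delete {S : α → SignType} (hS : M.IsSample S) (A : Finset α) :
    (M.delete A).IsSample (SignVec.delete S A) := by
  obtain ⟨X, hX, hle⟩ := hS
  refine ⟨_, delete_mem_covectors A hX, fun e he => ?_⟩
  have hA : e ∉ A := fun h => he (delete_of_mem _ h)
  rw [delete_of_notMem _ hA] at he ⊢
  rw [delete_of_notMem _ hA, hle e he]

theorem zeroSet_delete {S : α → SignType} (A : Finset α) :
    (M.delete A).zeroSet (SignVec.delete S A) = M.zeroSet S \ A := by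
  ext e
  by_cases hA : e ∈ A <;>
    simp [zeroSet, mem_ground_delete, hA, delete_of_notMem]

theorem delete_empty (M : SignSystem α) : M.delete ∅ = M := by
  refine ext_of_eq (Finset.sdiff_empty) ?_
  change (fun X => SignVec.delete X ∅) '' M.covectors = M.covectors
  have : ∀ X : α → SignType, SignVec.delete X ∅ = X := fun X => by
    funext e; exact delete_of_notMem _ (Finset.notMem_empty e)
  simp only [this, Set.image_id']

theorem mem_topeFamily {A : Finset α} :
    A ∈ M.topeFamily ↔ A ⊆ M.ground ∧ ∃ T, M.IsTope T ∧ ∀ e, e ∈ A ↔ T e = 1 := by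
  simp only [topeFamily, Finset.mem_filter, Finset.mem_powerset]

theorem mem_covectors_delete {A : Finset α} {X : α → SignType} :
    X ∈ (M.delete A).covectors ↔ ∃ Y ∈ M.covectors, SignVec.delete Y A = X := Iff.rfl

/-! ### Shattering as independence, VC-dimension as rank -/

namespace IsOM

theorem shatters_iff (hM : M.IsOM) {D : Finset α} :
    M.Shatters D ↔
      ∀ σ : α → SignType, (∀ e ∈ D, σ e ≠ 0) → ∃ Y ∈ M.covectors, ∀ e ∈ D, Y e = σ e := by
  constructor
  · intro h σ hσ
    have hD : D ⊆ M.ground := by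
      obtain ⟨u, hu, hDu⟩ := h.exists_superset
      exact hDu.trans (mem_topeFamily.1 hu).1
    obtain ⟨u, hu, ht⟩ := h (Finset.filter_subset (fun e => σ e = 1) D)
    obtain ⟨-, T, hT, huT⟩ := mem_topeFamily.1 hu
    obtain ⟨hTc, hTn⟩ := hM.isTope_iff.1 hT
    refine ⟨T, hTc, fun e he => ?_⟩
    have h1 : T e = 1 ↔ σ e = 1 := by
      have := congrArg (e ∈ ·) ht
      simpa [he, huT] using this
    have h2 := hTn e (hD he)
    have h3 := hσ e he
    revert h1 h2 h3
    generalize T e = a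
    generalize σ e = b
    decide +revert
  · intro h t ht
    obtain ⟨Y, hY, hYσ⟩ := h (fun e => if e ∈ t then 1 else -1) fun e _ => by
      split_ifs <;> decide
    obtain ⟨T, hT, hle⟩ := hM.exists_isTope_ge hY
    have hYn : ∀ e ∈ D, T e = if e ∈ t then 1 else -1 := fun e he => by
      rw [← hle e, hYσ e he]
      rw [hYσ e he]
      split_ifs <;> decide
    refine ⟨M.ground.filter fun e => T e = 1, mem_topeFamily.2 ⟨
      Finset.filter_subset _ _, T, hT, fun e => ?_⟩, ?_⟩
    · rw [Finset.mem_filter, and_iff_right_iff_imp]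
      intro he
      exact mem_ground_of_ne_zero hT.1 (by rw [he]; decide)
    · ext e
      rw [Finset.mem_inter, Finset.mem_filter]
      constructor
      · rintro ⟨heD, -, he⟩
        rw [hYn e heD] at he
        by_contra h
        rw [if_neg h] at he
        revert he; decide
      · intro he
        have : T e = 1 := by rw [hYn e (ht he), if_pos he]
        exact ⟨ht he, mem_ground_of_ne_zero hT.1 (by rw [this]; decide), this⟩

theorem subset_ground_of_shatters (hM : M.IsOM) {D : Finset α} (hD : M.Shatters D) :
    D ⊆ M.ground := fun e he => by
  obtain ⟨Y, hY, h⟩ := hM.shatters_iff.1 hD (fun _ => 1) fun _ _ => by decide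
  exact mem_ground_of_ne_zero hY (by rw [h e he]; decide)

/-- On a shattered set, every sign pattern (possibly with zeros) extends to a covector. -/
theorem exists_extension (hM : M.IsOM) {D : Finset α} (hD : M.Shatters D) (σ : α → SignType) :
    ∃ Y ∈ M.covectors, ∀ e ∈ D, Y e = σ e := by
  induction hn : (D.filter fun e => σ e = 0).card generalizing σ with
  | zero =>
    refine hM.shatters_iff.1 hD σ fun e he h => ?_
    rw [Finset.card_eq_zero] at hn
    have : e ∈ D.filter fun e => σ e = 0 := Finset.mem_filter.2 ⟨he, h⟩
    rw [hn] at this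
    exact Finset.notMem_empty _ this
  | succ n ih =>
    obtain ⟨f, hf⟩ := Finset.card_pos.1 (lt_of_lt_of_eq (Nat.succ_pos n) hn.symm)
    obtain ⟨hfD, hf0⟩ := Finset.mem_filter.1 hf
    have hcard : ∀ s : SignType, s ≠ 0 →
        (D.filter fun e => Function.update σ f s e = 0).card = n := fun s hs => by
      have : (D.filter fun e => Function.update σ f s e = 0) =
          (D.filter fun e => σ e = 0).erase f := by
        ext e
        by_cases h : e = f
        · subst h; simp [hs]
        · simp [h]
      rw [this, Finset.card_erase_of_mem hf, hn, Nat.add_sub_cancel]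
    -- A prescribed zero at `f` comes from eliminating `f` between the fillings by `1` and `-1`,
    -- which agree on the rest of `D`.
    obtain ⟨X, hX, hXσ⟩ := ih _ (hcard 1 (by decide))
    obtain ⟨Y, hY, hYσ⟩ := ih _ (hcard (-1) (by decide))
    have hXf : X f = 1 := by rw [hXσ f hfD, Function.update_self]
    have hYf : Y f = -1 := by rw [hYσ f hfD, Function.update_self]
    obtain ⟨Z, hZ, h0, h⟩ := hM.strong_elim X hX Y hY f
      (mem_sep.2 ⟨by rw [hXf]; decide, by rw [hXf, hYf]⟩)
    refine ⟨Z, hZ, fun e he => ?_⟩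
    by_cases hef : e = f
    · rw [hef, h0, hf0]
    · have h1 := hXσ e he
      have h2 := hYσ e he
      rw [Function.update_of_ne hef] at h1 h2
      rw [h e fun hs => ?_]
      · by_cases hz : X e = 0
        · rw [comp_of_eq _ hz, h2]
        · rw [comp_of_ne _ hz, h1]
      · rw [mem_sep, h1, h2] at hs
        exact ne_neg_self hs.1 hs.2

/-- Up to negation `Y` sets the sign at `g`; being zero on `D`, it leaves the pattern there to
whatever is composed after it. -/
theorem shatters_insert (hM : M.IsOM) {D : Finset α} (hD : M.Shatters D) {Y : α → SignType}
    (hY : Y ∈ M.covectors) (hYD : ∀ e ∈ D, Y e = 0) {g : α} (hg : Y g ≠ 0) :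
    M.Shatters (insert g D) := by
  rw [hM.shatters_iff]
  intro σ hσ
  obtain ⟨V, hV, hVσ⟩ := hM.exists_extension hD σ
  obtain ⟨Z, hZ, hZg, hz⟩ := hM.exists_sign hY hg (hσ g (Finset.mem_insert_self _ _))
  refine ⟨comp Z V, hM.comp_mem Z hZ V hV, fun e he => ?_⟩
  by_cases heg : e = g
  · rw [heg, comp_of_ne _ (hZg ▸ hσ g (Finset.mem_insert_self _ _)), hZg]
  · have heD := Finset.mem_of_mem_insert_of_ne he heg
    rw [comp_of_eq _ ((hz e).1 (hYD e heD)), hVσ e heD]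

theorem shatters_delete (hM : M.IsOM) {A D : Finset α} :
    (M.delete A).Shatters D ↔ M.Shatters D ∧ Disjoint D A := by
  constructor
  · intro h
    have hd : ∀ e ∈ D, e ∉ A := fun e he =>
      (mem_ground_delete.1 ((hM.delete A).subset_ground_of_shatters h he)).2
    refine ⟨hM.shatters_iff.2 fun σ _ => ?_, Finset.disjoint_left.2 fun e he => hd e he⟩
    obtain ⟨_, hY', hYσ⟩ := (hM.delete A).exists_extension h σ
    obtain ⟨Y, hY, rfl⟩ := mem_covectors_delete.1 hY'
    exact ⟨Y, hY, fun e he => by rw [← hYσ e he, delete_of_notMem _ (hd e he)]⟩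
  · rintro ⟨h, hd⟩
    refine (hM.delete A).shatters_iff.2 fun σ _ => ?_
    obtain ⟨Y, hY, hYσ⟩ := hM.exists_extension h σ
    exact ⟨_, delete_mem_covectors A hY, fun e he => by
      rw [delete_of_notMem _ (Finset.disjoint_left.1 hd he), hYσ e he]⟩

theorem exists_shatters_card_eq (hM : M.IsOM) : ∃ D, M.Shatters D ∧ D.card = M.vcDim := by
  have hne : M.topeFamily.shatterer.Nonempty := ⟨∅, Finset.mem_shatterer.2 <|
    hM.shatters_iff.2 fun _ _ => ⟨0, hM.zero_mem, by simp⟩⟩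
  obtain ⟨D, hD, h⟩ := Finset.exists_mem_eq_sup _ hne Finset.card
  exact ⟨D, Finset.mem_shatterer.1 hD, h.symm⟩

theorem shatters_insert_of_delete_supp (hM : M.IsOM) {X : α → SignType} (hX : X ∈ M.covectors)
    {D : Finset α} (hD : (M.delete (M.supp X)).Shatters D) {e : α} (he : X e ≠ 0) :
    e ∉ D ∧ M.Shatters (insert e D) := by
  obtain ⟨h, hd⟩ := hM.shatters_delete.1 hD
  refine ⟨fun heD => Finset.disjoint_left.1 hd heD ((mem_supp hX).2 he),
    hM.shatters_insert h hX (fun f hf => ?_) he⟩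
  by_contra hne
  exact Finset.disjoint_left.1 hd hf ((mem_supp hX).2 hne)

theorem vcDim_delete_supp_lt (hM : M.IsOM) {X : α → SignType} (hX : X ∈ M.covectors)
    {e : α} (he : X e ≠ 0) : (M.delete (M.supp X)).vcDim + 1 ≤ M.vcDim := by
  obtain ⟨D, hD, hc⟩ := (hM.delete (M.supp X)).exists_shatters_card_eq
  obtain ⟨h1, h2⟩ := hM.shatters_insert_of_delete_supp hX hD he
  rw [← hc, ← Finset.card_insert_of_notMem h1]
  exact h2.card_le_vcDim

/-- The complement of the support of a cocircuit is a hyperplane. -/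
theorem vcDim_delete_supp (hM : M.IsOM) {X : α → SignType} (hX : M.IsCocircuit X) :
    (M.delete (M.supp X)).vcDim + 1 = M.vcDim := by
  obtain ⟨e, he⟩ : ∃ e, X e ≠ 0 := by
    by_contra! h
    exact hX.2.1 (funext h)
  refine le_antisymm (hM.vcDim_delete_supp_lt hX.1 he) ?_
  let 𝒟 := M.topeFamily.shatterer.filter fun D => D.card = M.vcDim
  have hne : 𝒟.Nonempty := by
    obtain ⟨D, hD, hc⟩ := hM.exists_shatters_card_eq
    exact ⟨D, Finset.mem_filter.2 ⟨Finset.mem_shatterer.2 hD, hc⟩⟩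
  -- Take a basis with as many elements as possible off the support of `X`. If it had two elements
  -- `a`, `b` in the support, a covector vanishing on the basis except at `a` would be nonzero at
  -- some `g` off the support, and exchanging `a` for `g` would improve the basis.
  obtain ⟨D, hD, hmax⟩ := 𝒟.exists_max_image (fun D => (D \ M.supp X).card) hne
  obtain ⟨hDs, hDc⟩ := Finset.mem_filter.1 hD
  rw [Finset.mem_shatterer] at hDs
  have hcard : (D ∩ M.supp X).card ≤ 1 := by
    refine Finset.card_le_one.2 fun a ha b hb => ?_
    by_contra hab
    rw [Finset.mem_inter, mem_supp hX.1] at ha hb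
    obtain ⟨Y, hY, hYσ⟩ := hM.exists_extension hDs (fun f => if f = a then 1 else 0)
    have hYa : Y a ≠ 0 := by rw [hYσ a ha.1, if_pos rfl]; decide
    have hYb : Y b = 0 := by rw [hYσ b hb.1, if_neg (Ne.symm hab)]
    obtain ⟨g, hgX, hgY⟩ : ∃ g, X g = 0 ∧ Y g ≠ 0 := by
      by_contra! h
      exact hM.ne_zero_of_isCocircuit hX hY h hYa hb.2 hYb
    have hYD : ∀ f ∈ D.erase a, Y f = 0 := fun f hf => by
      rw [hYσ f (Finset.mem_of_mem_erase hf), if_neg (Finset.ne_of_mem_erase hf)]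
    have hgD : g ∉ D.erase a := fun h => hgY (hYD g h)
    have hD' : insert g (D.erase a) ∈ 𝒟 := by
      refine Finset.mem_filter.2 ⟨Finset.mem_shatterer.2 (hM.shatters_insert
        (Finset.Shatters.mono_right (Finset.erase_subset a D) hDs) hY hYD hgY), ?_⟩
      rw [Finset.card_insert_of_notMem hgD, Finset.card_erase_add_one ha.1, hDc]
    refine absurd (hmax _ hD') (not_le.2 (Finset.card_lt_card ?_))
    refine Finset.ssubset_iff_subset_ne.2 ⟨fun f hf => ?_, fun heq => ?_⟩
    · rw [Finset.mem_sdiff] at hf ⊢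
      refine ⟨Finset.mem_insert_of_mem (Finset.mem_erase.2 ⟨?_, hf.1⟩), hf.2⟩
      rintro rfl
      exact hf.2 ((mem_supp hX.1).2 ha.2)
    · have : g ∈ insert g (D.erase a) \ M.supp X :=
        Finset.mem_sdiff.2 ⟨Finset.mem_insert_self _ _, by rw [mem_supp hX.1]; exact not_not.2 hgX⟩
      rw [← heq, Finset.mem_sdiff] at this
      refine hgD (Finset.mem_erase.2 ⟨?_, this.1⟩)
      rintro rfl
      exact ha.2 hgX
  have h1 : (M.delete (M.supp X)).Shatters (D \ M.supp X) :=
    hM.shatters_delete.2 ⟨Finset.Shatters.mono_right Finset.sdiff_subset hDs,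
      Finset.sdiff_disjoint⟩
  have h2 := h1.card_le_vcDim
  have h3 := Finset.card_sdiff_add_card_inter D (M.supp X)
  unfold vcDim at *
  omega

/-! ### The recursion yields a basis inside `osc` -/

theorem isTope_delete (hM : M.IsOM) {T : α → SignType} (hT : M.IsTope T) (A : Finset α) :
    (M.delete A).IsTope (SignVec.delete T A) := by
  obtain ⟨h, hn⟩ := hM.isTope_iff.1 hT
  refine (hM.delete A).isTope_iff.2 ⟨delete_mem_covectors A h, fun e he => ?_⟩
  rw [mem_ground_delete] at he
  rw [delete_of_notMem _ he.2]
  exact hn e he.1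

theorem isTope_delete_zeroSet (hM : M.IsOM) {S : α → SignType} (hS : M.IsSample S) :
    (M.delete (M.zeroSet S)).IsTope S := by
  obtain ⟨X, hX, hle⟩ := hS
  refine (hM.delete _).isTope_iff.2 ⟨⟨X, hX, ?_⟩, fun e he h => ?_⟩
  · funext e
    by_cases h : S e = 0
    · by_cases he : e ∈ M.ground
      · rw [h]
        exact delete_of_mem _ ((mem_zeroSet he).2 h)
      · refine Eq.trans (delete_of_notMem _ fun h' => he (Finset.mem_filter.1 h').1) ?_
        rw [M.eq_zero_of_notMem X hX e he, h]
    · exact (delete_of_notMem _ fun h' => h (zero_of_mem_zeroSet h')).trans (hle e h).symm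
  · rw [mem_ground_delete] at he
    exact he.2 ((mem_zeroSet he.1).2 h)

theorem distinguish_of_isTope (hM : M.IsOM) {S : α → SignType} (hS : M.IsTope S)
    (hU : M.ground.Nonempty) :
    ∃ e X, IsLeast (M.osc (M.cell S)) e ∧ M.IsCocircuit X ∧ X e ≠ 0 ∧ Le X S ∧
      M.distinguish S = insert e
        ((M.delete (M.supp X)).distinguish (SignVec.delete S (M.supp X))) := by
  have hne := hM.osc_cell_nonempty hS hU
  have hfin : (M.osc (M.cell S)).Finite := M.ground.finite_toSet.subset fun e he => he.1
  obtain ⟨e, he⟩ : ∃ e, IsLeast (M.osc (M.cell S)) e := by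
    obtain ⟨e, he, h⟩ := Set.exists_min_image _ id hfin hne
    exact ⟨e, he, h⟩
  obtain ⟨X, hX⟩ := exists_isLexMin (M := M) (C := M.lowerCocircuits S e) (fun X h => h.1.1)
    (hM.exists_lowerCocircuit hS.1 ((hM.isTope_iff.1 hS).2 e he.1.1))
  have h : ∃ p : α × (α → SignType),
      IsLeast (M.osc (M.cell S)) p.1 ∧ IsLexMin (M.lowerCocircuits S p.1) p.2 := ⟨(e, X), he, hX⟩
  refine ⟨h.choose.1, h.choose.2, h.choose_spec.1, h.choose_spec.2.1.1, h.choose_spec.2.1.2.1,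
    h.choose_spec.2.1.2.2, ?_⟩
  rw [distinguish, if_pos hS, dif_pos h]


theorem distinguish_of_ground_eq_empty (S : α → SignType) (hU : M.ground = ∅) :
    M.distinguish S = ∅ := by
  rw [distinguish]
  split_ifs with h1 h2 h3
  · obtain ⟨p, hp, -⟩ := h2
    have := hp.1.1
    rw [hU] at this
    exact absurd this (Finset.notMem_empty _)
  · rfl
  · obtain ⟨e, he⟩ := h3
    have := (Finset.mem_filter.1 he).1
    rw [hU] at this
    exact absurd this (Finset.notMem_empty _)
  · rfl

/-- Covers both branches of the recursion: for a tope the zero set is empty. The sample is unchanged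
because of its encoding by zeros. -/
theorem distinguish_eq_delete_zeroSet (hM : M.IsOM) (S : α → SignType) :
    M.distinguish S = (M.delete (M.zeroSet S)).distinguish S := by
  by_cases h0 : M.zeroSet S = ∅
  · rw [h0, delete_empty]
  · have hT : ¬ M.IsTope S := fun hT => by
      obtain ⟨e, he⟩ := Finset.nonempty_iff_ne_empty.2 h0
      obtain ⟨he, hz⟩ := Finset.mem_filter.1 he
      exact (hM.isTope_iff.1 hT).2 e he hz
    rw [distinguish, if_neg hT, dif_pos (Finset.nonempty_iff_ne_empty.2 h0), delete_zeroSet]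

theorem vcDim_eq_zero_of_ground_eq_empty (hM : M.IsOM) (hU : M.ground = ∅) : M.vcDim = 0 := by
  obtain ⟨D, hD, hc⟩ := hM.exists_shatters_card_eq
  have := hM.subset_ground_of_shatters hD
  rw [hU, Finset.subset_empty] at this
  rw [← hc, this, Finset.card_empty]

theorem distinguish_tope_spec (hM : M.IsOM) {S : α → SignType} (hS : M.IsTope S) :
    (M.distinguish S).card = M.vcDim ∧ (M.distinguish S : Set α) ⊆ M.osc (M.cell S) ∧
      M.Shatters (M.distinguish S) := by
  induction hn : M.ground.card using Nat.strong_induction_on generalizing M S with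
  | _ n ih =>
    rcases M.ground.eq_empty_or_nonempty with hU | hU
    · rw [distinguish_of_ground_eq_empty S hU, vcDim_eq_zero_of_ground_eq_empty hM hU]
      refine ⟨rfl, by simp, hM.shatters_iff.2 fun _ _ => ⟨0, hM.zero_mem, by simp⟩⟩
    · obtain ⟨e, X, he, hX, hXe, hle, hD⟩ := hM.distinguish_of_isTope hS hU
      have heU := mem_ground_of_ne_zero hX.1 hXe
      obtain ⟨hc, hosc, hsh⟩ := ih (M.delete (M.supp X)).ground.card
        (hn ▸ Finset.card_lt_card (Finset.sdiff_ssubset (Finset.filter_subset _ _)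
          ⟨e, (mem_supp hX.1).2 hXe⟩)) (hM.delete (M.supp X)) (hM.isTope_delete hS _) rfl
      rw [hD]
      obtain ⟨h1, h2⟩ := hM.shatters_insert_of_delete_supp hX.1 hsh hXe
      refine ⟨?_, ?_, h2⟩
      · rw [Finset.card_insert_of_notMem h1, hc, hM.vcDim_delete_supp hX]
      · rw [Finset.coe_insert, Set.insert_subset_iff]
        refine ⟨he.1, hosc.trans fun g hg => ?_⟩
        rw [(hM.delete _).mem_osc_cell ⟨_, (hM.isTope_delete hS _).1, Le.refl _⟩] at hg
        obtain ⟨hSg, _, hY', hYg, hYS⟩ := hg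
        obtain ⟨Y, hY, rfl⟩ := mem_covectors_delete.1 hY'
        have hgX : g ∉ M.supp X := fun h => hSg (delete_of_mem _ h)
        have hgX0 : X g = 0 := by
          rw [mem_supp hX.1] at hgX; exact not_not.1 hgX
        rw [delete_of_notMem _ hgX] at hSg hYg
        -- `X ≤ S` matches `S` on its support, and `Y` does so on the remaining elements other than
        -- `g`.
        refine (hM.mem_osc_cell ⟨S, hS.1, Le.refl S⟩).2 ⟨hSg, comp X Y,
          hM.comp_mem X hX.1 Y hY, by rw [comp_of_eq _ hgX0, hYg], fun f hfg hf => ?_⟩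
        by_cases hXf : X f = 0
        · have hfX : f ∉ M.supp X := by rw [mem_supp hX.1]; exact not_not.2 hXf
          have := hYS f hfg
          rw [delete_of_notMem _ hfX, delete_of_notMem _ hfX] at this
          rw [comp_of_eq _ hXf, this hf]
        · rw [comp_of_ne _ hXf, hle f hXf]

theorem topeFamily_delete (hM : M.IsOM) (A : Finset α) :
    M.topeFamily.image (fun B => B \ A) = (M.delete A).topeFamily := by
  ext B
  simp only [Finset.mem_image, mem_topeFamily]
  constructor
  · rintro ⟨C, ⟨hC, T, hT, hTC⟩, rfl⟩
    refine ⟨Finset.sdiff_subset_sdiff hC le_rfl, _, hM.isTope_delete hT A, fun e => ?_⟩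
    by_cases he : e ∈ A
    · simp [he, delete_of_mem]
    · simp [he, delete_of_notMem, hTC]
  · rintro ⟨hB, T, hT, hTB⟩
    obtain ⟨⟨Y, hY, rfl⟩, hn⟩ := (hM.delete A).isTope_iff.1 hT
    obtain ⟨T, hT, hle⟩ := hM.exists_isTope_ge hY
    refine ⟨M.ground.filter fun e => T e = 1, ⟨Finset.filter_subset _ _, T, hT, fun e => ?_⟩, ?_⟩
    · rw [Finset.mem_filter, and_iff_right_iff_imp]
      intro he
      exact mem_ground_of_ne_zero hT.1 (by rw [he]; decide)
    · ext e
      rw [Finset.mem_sdiff, Finset.mem_filter, hTB]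
      by_cases he : e ∈ A
      · simp [he, delete_of_mem]
      · simp only [he, delete_of_notMem, not_false_eq_true, and_true]
        by_cases heg : e ∈ M.ground
        · have := hn e (mem_ground_delete.2 ⟨heg, he⟩)
          simp only [delete_of_notMem _ he] at this
          rw [hle e this]
          simp [heg]
        · rw [M.eq_zero_of_notMem Y hY e heg]
          simp [heg]

theorem isFull_iff (hM : M.IsOM) {S : α → SignType} :
    M.IsFull S ↔ M.IsSample S ∧ (M.delete (M.zeroSet S)).vcDim = M.vcDim := by
  rw [IsFull, hM.topeFamily_delete]
  rfl

theorem distinguish_spec (hM : M.IsOM) {S : α → SignType} (hS : M.IsFull S) :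
    (M.distinguish S).card = M.vcDim ∧ (M.distinguish S : Set α) ⊆ M.osc (M.cell S) ∧
      M.Shatters (M.distinguish S) := by
  obtain ⟨hS, hfull⟩ := hM.isFull_iff.1 hS
  have hN := hM.delete (M.zeroSet S)
  have hT := hM.isTope_delete_zeroSet hS
  obtain ⟨hc, hosc, hsh⟩ := hN.distinguish_tope_spec hT
  rw [hM.distinguish_eq_delete_zeroSet S]
  refine ⟨hc.trans hfull, hosc.trans fun e he => ?_, (hM.shatters_delete.1 hsh).1⟩
  rw [hN.mem_osc_cell ⟨S, hT.1, Le.refl S⟩] at he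
  obtain ⟨hSe, _, ⟨Y, hY, rfl⟩, hYe, hYS⟩ := he
  have hz : ∀ f, S f ≠ 0 → SignVec.delete Y (M.zeroSet S) f = Y f := fun f hf =>
    delete_of_notMem _ fun h => hf (zero_of_mem_zeroSet h)
  exact (hM.mem_osc_cell hS).2 ⟨hSe, Y, hY, by rw [← hz e hSe]; exact hYe, fun f hfe hf => by
    rw [← hz f hf]; exact hYS f hfe hf⟩

/-! ### Common topes of equivalent samples -/

/-- A covector that vanishes on all but one element of a basis is determined up to sign. -/
theorem eq_of_basis (hM : M.IsOM) {D : Finset α} {e : α} (hD : M.Shatters (insert e D))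
    (hc : (insert e D).card = M.vcDim) {X Y : α → SignType} (hX : X ∈ M.covectors)
    (hY : Y ∈ M.covectors) (hX0 : ∀ f ∈ D, X f = 0) (hY0 : ∀ f ∈ D, Y f = 0)
    (he : X e ≠ 0) (hXY : X e = Y e) : X = Y := by
  by_contra hne
  obtain ⟨f, hf⟩ : ∃ f, X f ≠ Y f := by
    by_contra! h
    exact hne (funext h)
  -- `Z` vanishes on the whole basis but not at `f`, so the basis could be enlarged.
  obtain ⟨Z, hZ, h0, h⟩ := hM.strong_elim X hX (-Y) (hM.neg_mem Y hY) e
    (mem_sep.2 ⟨he, by rw [Pi.neg_apply, hXY]⟩)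
  have hns : ∀ g, g ∉ sep X (-Y) ↔ X g = 0 ∨ X g ≠ Y g := fun g => by
    rw [mem_sep, Pi.neg_apply]
    generalize X g = a
    generalize Y g = b
    decide +revert
  have hZ0 : ∀ g ∈ insert e D, Z g = 0 := fun g hg => by
    rcases Finset.mem_insert.1 hg with rfl | hg
    · exact h0
    · rw [h g ((hns g).2 (.inl (hX0 g hg))), comp_of_eq _ (hX0 g hg), Pi.neg_apply, hY0 g hg]
      decide
  have hZf : Z f ≠ 0 := by
    rw [h f ((hns f).2 (.inr hf))]
    refine comp_ne_zero ?_
    rw [Pi.neg_apply]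
    revert hf
    generalize X f = a
    generalize Y f = b
    decide +revert
  have h1 := (hM.shatters_insert hD hZ hZ0 hZf).card_le_vcDim
  rw [Finset.card_insert_of_notMem fun hfD => hZf (hZ0 f hfD), hc] at h1
  unfold vcDim at h1
  omega

/-- All full samples with the same image under `distinguish` and the same signs there extend to a
common tope. -/
theorem exists_common_tope (hM : M.IsOM) (D : Finset α) (σ : α → SignType) :
    ∃ T, M.IsTope T ∧ ∀ S, M.IsFull S → M.distinguish S = D → (∀ e ∈ D, S e = σ e) → Le S T := by
  induction hn : D.card generalizing M D with
  | zero =>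
    obtain ⟨T, hT⟩ := hM.exists_isTope
    refine ⟨T, hT, fun S hS hSD _ e he => ?_⟩
    exfalso
    -- Rank zero leaves no room for an element in the support of `S`: a covector nonzero there
    -- forces positive rank.
    have hc := (hM.distinguish_spec hS).1
    rw [hSD, hn] at hc
    have heg := hS.1.mem_ground he
    obtain ⟨X, hX, h⟩ := hM.simple.all_signs e heg 1
    have := hM.vcDim_delete_supp_lt hX (e := e) (by rw [h]; decide)
    omega
  | succ n ih =>
    by_cases hex : ∃ S, M.IsFull S ∧ M.distinguish S = D ∧ ∀ e ∈ D, S e = σ e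
    swap
    · obtain ⟨T, hT⟩ := hM.exists_isTope
      exact ⟨T, hT, fun S h1 h2 h3 => absurd ⟨S, h1, h2, h3⟩ hex⟩
    have hDne : D.Nonempty := Finset.card_pos.1 (hn ▸ Nat.succ_pos n)
    set e := D.min' hDne with he
    have heD : e ∈ D := D.min'_mem hDne
    obtain ⟨hDc, hDs, hσe⟩ : D.card = M.vcDim ∧ M.Shatters D ∧ σ e ≠ 0 := by
      obtain ⟨S, hS, rfl, hSσ⟩ := hex
      obtain ⟨h1, h2, h3⟩ := hM.distinguish_spec hS
      exact ⟨h1, h3, hSσ e heD ▸ ((hM.mem_osc_cell hS.1).1 (h2 heD)).1⟩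
    -- `V` is chosen from `D` and `σ` alone, before any particular sample is considered.
    obtain ⟨V, hV, hVσ⟩ := hM.exists_extension hDs (fun f => if f = e then σ e else 0)
    have hVe : V e = σ e := by rw [hVσ e heD, if_pos rfl]
    have hVe0 : V e ≠ 0 := hVe ▸ hσe
    have hV0 : ∀ f ∈ D.erase e, V f = 0 := fun f hf => by
      rw [hVσ f (Finset.mem_of_mem_erase hf), if_neg (Finset.ne_of_mem_erase hf)]
    obtain ⟨T, hT, hall⟩ := ih (hM.delete (M.supp V)) (D.erase e)
      (by rw [Finset.card_erase_of_mem heD, hn, Nat.add_sub_cancel])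
    obtain ⟨⟨Y, hY, rfl⟩, hTn⟩ := (hM.delete (M.supp V)).isTope_iff.1 hT
    have hYV : ∀ f, V f = 0 → SignVec.delete Y (M.supp V) f = Y f := fun f hf =>
      delete_of_notMem _ (by rw [mem_supp hV]; exact not_not.2 hf)
    refine ⟨comp V Y, hM.isTope_iff.2 ⟨hM.comp_mem V hV Y hY, fun f hf => comp_ne_zero ?_⟩,
      fun S hS hSD hSσ => ?_⟩
    · by_cases hVf : V f = 0
      · refine .inr ?_
        rw [← hYV f hVf]
        exact hTn f (mem_ground_delete.2 ⟨hf, by rw [mem_supp hV]; exact not_not.2 hVf⟩)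
      · exact .inl hVf
    obtain ⟨hSs, hSfull⟩ := hM.isFull_iff.1 hS
    have hS0 := hM.isTope_delete_zeroSet hSs
    have hN := hM.delete (M.zeroSet S)
    set N := M.delete (M.zeroSet S) with hNdef
    rw [hM.distinguish_eq_delete_zeroSet S] at hSD
    obtain ⟨hNc, hNosc, hNsh⟩ := hN.distinguish_tope_spec hS0
    have hNU : N.ground.Nonempty := by
      rw [Finset.nonempty_iff_ne_empty]
      intro h
      rw [distinguish_of_ground_eq_empty S h] at hSD
      exact hDne.ne_empty hSD.symm
    obtain ⟨e', X, he', hX, hXe, hXS, hD'⟩ := hN.distinguish_of_isTope hS0 hNU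
    rw [hSD] at hD' hNosc hNc hNsh
    -- `D` lies in `osc` of the cell and contains `e'`, the least element of that set.
    have hee' : e' = e := by
      refine le_antisymm (he'.2 (hNosc heD)) (D.min'_le e' ?_)
      rw [hD']
      exact Finset.mem_insert_self _ _
    rw [hee'] at hD' hXe
    have hspec := (hN.delete (N.supp X)).distinguish_tope_spec (hN.isTope_delete hS0 (N.supp X))
    set D' := (N.delete (N.supp X)).distinguish (SignVec.delete S (N.supp X)) with hD'def
    obtain ⟨hc', -, hsh'⟩ := hspec
    have heD' : e ∉ D' := (hN.shatters_insert_of_delete_supp hX.1 hsh' hXe).1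
    have hDe : D.erase e = D' := by rw [hD', Finset.erase_insert heD']
    have hX0 : ∀ f ∈ D', X f = 0 := fun f hf => by
      by_contra h
      exact Finset.disjoint_left.1 (hN.shatters_delete.1 hsh').2 hf ((mem_supp hX.1).2 h)
    have hDN : ∀ f ∈ D, f ∉ M.zeroSet S := fun f hf =>
      (mem_ground_delete.1 (hN.subset_ground_of_shatters hNsh hf)).2
    -- In `N` both covectors vanish on the basis `D` except at `e`, where both have sign `σ e`.
    have hXV : X = SignVec.delete V (M.zeroSet S) := by
      refine hN.eq_of_basis (D := D') (e := e) (hD' ▸ hNsh) (hD' ▸ hNc) hX.1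
        (delete_mem_covectors _ hV) hX0 (fun f hf => ?_) hXe ?_
      · rw [← hDe] at hf
        rw [delete_of_notMem _ (hDN f (Finset.mem_of_mem_erase hf)), hV0 f hf]
      · rw [delete_of_notMem _ (hDN e heD), hVe, hXS e hXe, hSσ e heD]
    have hsuppX : N.supp X = M.supp V \ M.zeroSet S := by
      ext f
      rw [mem_supp hX.1, Finset.mem_sdiff, mem_supp hV, hXV]
      by_cases hf : f ∈ M.zeroSet S
      · simp [hf, delete_of_mem]
      · simp [hf, delete_of_notMem]
    -- Exchanging the order of the deletions turns the recursive call into one for a sample of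
    -- `M.delete (M.supp V)`, a matroid independent of `S`.
    have hdel : N.delete (N.supp X) = (M.delete (M.supp V)).delete (M.zeroSet S \ M.supp V) := by
      rw [hNdef, delete_delete, delete_delete, ← hNdef, hsuppX, Finset.union_sdiff_self_eq_union,
        Finset.union_sdiff_self_eq_union, Finset.union_comm]
    have hSdel : SignVec.delete S (N.supp X) = SignVec.delete S (M.supp V) := by
      rw [hsuppX, ← delete_zeroSet M S, SignVec.delete_delete, SignVec.delete_delete,
        delete_zeroSet, Finset.union_sdiff_self_eq_union]
    have hS1 : (M.delete (M.supp V)).IsSample (SignVec.delete S (M.supp V)) := hSs.delete _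
    have hMV := hM.delete (M.supp V)
    rw [hdel, hSdel, ← zeroSet_delete] at hD'def
    rw [← hMV.distinguish_eq_delete_zeroSet _] at hD'def
    have hle : Le (SignVec.delete S (M.supp V)) (SignVec.delete Y (M.supp V)) := by
      refine hall _ (hMV.isFull_iff.2 ⟨hS1, ?_⟩) (hD'def.symm.trans hDe.symm) fun f hf => ?_
      -- Fullness: `D'` has `n` elements and remains shattered before the zeros of `S` are deleted,
      -- while deleting the support of `V` brings the rank `n + 1` down to at most `n`.
      · rw [zeroSet_delete, ← hdel, ← hc']
        refine le_antisymm (Finset.Shatters.card_le_vcDim ?_) ?_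
        · rw [hdel] at hsh'
          exact (hMV.shatters_delete.1 hsh').1
        · have h1 := hM.vcDim_delete_supp_lt hV hVe0
          have h2 : D'.card = n := by
            rw [← hDe, Finset.card_erase_of_mem heD, hn, Nat.add_sub_cancel]
          omega
      · rw [delete_of_notMem _ (by rw [mem_supp hV]; exact not_not.2 (hV0 f hf))]
        exact hSσ f (Finset.mem_of_mem_erase hf)
    intro f hf
    by_cases hVf : V f = 0
    · have hfV : f ∉ M.supp V := by rw [mem_supp hV]; exact not_not.2 hVf
      have := hle f
      rw [delete_of_notMem _ hfV, delete_of_notMem _ hfV] at this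
      rw [comp_of_eq _ hVf, this hf]
    · have hXf : X f = V f := by
        rw [hXV, delete_of_notMem _ fun h => hf (zero_of_mem_zeroSet h)]
      rw [comp_of_ne _ hVf, ← hXf, hXS f (hXf ▸ hVf)]

end IsOM

end SignSystem

theorem mainTheorem2 {α : Type*} [LinearOrder α] (M : SignSystem α) (hM : M.IsOM)
    (d : ℕ) (hd : M.vcDim = d) :
    (∀ S : M.FullSample,
      M.distinguish S.1 ∈ M.ground.powersetCard d ∧
      (M.distinguish S.1 : Set α) ⊆ M.osc (M.cell S.1) ∧
      M.Shatters (M.distinguish S.1)) ∧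
    (∀ Ω ∈ M.fullSampleSetoid.classes, (⋂ S ∈ Ω, M.cell S.1).Nonempty) := by
  refine ⟨fun S => ?_, ?_⟩
  · obtain ⟨hc, hosc, hsh⟩ := hM.distinguish_spec S.2
    exact ⟨Finset.mem_powersetCard.2 ⟨hM.subset_ground_of_shatters hsh, hc.trans hd⟩, hosc, hsh⟩
  · rintro Ω ⟨S₀, rfl⟩
    obtain ⟨T, hT, h⟩ := hM.exists_common_tope (M.distinguish S₀.1) S₀.1
    refine ⟨T, Set.mem_iInter₂.2 fun S hS => ⟨hT, h S.1 S.2 hS.1 fun e he => ?_⟩⟩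
    exact hS.2 e (hS.1 ▸ he)
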